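/- Let QHC be the joint first-order calculus of problems and propositions. Its only terms are the individual variables $x_1,x_2,\dots$. Every formula has exactly one of two types, problem or proposition. Formulas are built from logical variables of each type and each arity $n\ge 0$, applied to terms, and from the constants $\bot$ (a problem) and $0$ (a proposition), by the connectives $\land,\lor,\to$ and quantifiers $\forall,\exists$ (applied to formulas of one type, and called intuitionistic on problems and classical on propositions), by $!$ (which turns a proposition $p$ into a problem $!p$) and by $?$ (which turns a problem $\alpha$ into a proposition $?\alpha$). Here $\neg A$ abbreviates $A\to\bot$ or $A\to 0$, and $A\leftrightarrow B$ abbreviates $(A\to B)\land(B\to A)$. The deductive system of QHC consists of intuitionistic predicate logic applied to all problems, classical predicate logic applied to all propositions, the axiom schemes $?(\alpha\land\beta)\leftrightarrow ?\alpha\land?\beta$, $?(\alpha\lor\beta)\leftrightarrow ?\alpha\lor?\beta$, $?(\alpha\to\beta)\to(?\alpha\to?\beta)$, $\neg?\bot$, $?\exists x\,\alpha(x)\leftrightarrow\exists x\,?\alpha(x)$, $?\forall x\,\alpha(x)\to\forall x\,?\alpha(x)$, $\neg!0$, $?!p\to p$, $!(p\to q)\to(!p\to!q)$, $\alpha\to!?\alpha$,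 and the inference rules $\alpha\,/\,?\alpha$ and $p\,/\,!p$. Write $\vdash A$ if $A$ is derivable in QHC. The formulas of the classical predicate calculus QC (respectively, of the intuitionistic predicate calculus QH) are the propositions (respectively, the problems) of QHC that contain neither $?$ nor $!$. Put $\Box=?!$ and $\Diamond=\neg\Box\neg$. For a formula $A$ of QHC, let $A_\Diamond$ be the formula of the same type obtained from $A$ by prefixing each classical $\to$ and each classical $\forall$ with $\Box$, and by prefixing each atomic proposition (including $0$), each occurrence of $?$, each classical $\lor$ and each classical $\exists$ with $\Box\Diamond\Box$; everything else is left unchanged. **Theorem.** For every formula $A$ of QHC, $\vdash A$ implies $\vdash A_\Diamond$. Conversely, if $A$ is a formula of QC or of QH, then $\vdash A_\Diamond$ implies $\vdash A$. Thus $A\mapsto A_\Diamond$ restricts to a type-preserving embedding of QC into QHC: a formula $p$ of QC is derivable in QC if and only if $\vdash p_\Diamond$. -/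

import Mathlib

/-- The two types of formulas of QHC: problems (intuitionistic) and propositions (classical). -/
inductive Kind : Type
  | problem
  | proposition

/-- Formulas of QHC, each of exactly one kind.  The only terms are the individual variables
`x₀, x₁, …`, represented by their indices.  `var k n i t` is the `i`-th `n`-ary logical variable of
kind `k`, applied to the terms `t`.  `fls` is `⊥` for problems and `0` for propositions.
The connectives and quantifiers are classical on propositions and intuitionistic on problems. -/
inductive Form : Kind → Type
  | var (k : Kind) (n i : ℕ) (t : Fin n → ℕ) : Form k
  | fls (k : Kind) : Form k
  | and {k : Kind} (A B : Form k) : Form k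
  | or {k : Kind} (A B : Form k) : Form k
  | imp {k : Kind} (A B : Form k) : Form k
  | all {k : Kind} (x : ℕ) (A : Form k) : Form k
  | ex {k : Kind} (x : ℕ) (A : Form k) : Form k
  | oc (p : Form Kind.proposition) : Form Kind.problem
  | wn (a : Form Kind.problem) : Form Kind.proposition

namespace Form

/-- Negation, an abbreviation for `A → ⊥` (problems) and `A → 0` (propositions). -/
def neg {k : Kind} (A : Form k) : Form k := imp A (fls k)

/-- `A ↔ B`, an abbreviation for `(A → B) ∧ (B → A)`. -/
def biimp {k : Kind} (A B : Form k) : Form k := and (imp A B) (imp B A)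

/-- `□ = ?!`. -/
def box (p : Form Kind.proposition) : Form Kind.proposition := wn (oc p)

/-- `◇ = ¬□¬`. -/
def diamond (p : Form Kind.proposition) : Form Kind.proposition := neg (box (neg p))

/-- The prefix `□◇□`. -/
def bdb (p : Form Kind.proposition) : Form Kind.proposition := box (diamond (box p))

/-- The individual variable `x` occurs freely in the formula. -/
def Free (x : ℕ) : {k : Kind} → Form k → Prop
  | _, var _ _ _ t => ∃ j, t j = x
  | _, fls _ => False
  | _, and A B => Free x A ∨ Free x B
  | _, or A B => Free x A ∨ Free x B
  | _, imp A B => Free x A ∨ Free x B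
  | _, all z A => z ≠ x ∧ Free x A
  | _, ex z A => z ≠ x ∧ Free x A
  | _, oc p => Free x p
  | _, wn a => Free x a

/-- Replace every free occurrence of the variable `x` by the variable `y` (meaningful when `y` is
free for `x`, see `FreeFor`). -/
def subst (x y : ℕ) : {k : Kind} → Form k → Form k
  | _, var k n i t => var k n i (fun j => if t j = x then y else t j)
  | _, fls k => fls k
  | _, and A B => and (subst x y A) (subst x y B)
  | _, or A B => or (subst x y A) (subst x y B)
  | _, imp A B => imp (subst x y A) (subst x y B)
  | _, all z A => if z = x then all z A else all z (subst x y A)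
  | _, ex z A => if z = x then ex z A else ex z (subst x y A)
  | _, oc p => oc (subst x y p)
  | _, wn a => wn (subst x y a)

/-- `y` is free for `x`: no free occurrence of `x` lies within the scope of a quantifier that
binds `y`. -/
def FreeFor (x y : ℕ) : {k : Kind} → Form k → Prop
  | _, var _ _ _ _ => True
  | _, fls _ => True
  | _, and A B => FreeFor x y A ∧ FreeFor x y B
  | _, or A B => FreeFor x y A ∧ FreeFor x y B
  | _, imp A B => FreeFor x y A ∧ FreeFor x y B
  | _, all z A => ¬ Free x (all z A) ∨ (z ≠ y ∧ FreeFor x y A)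
  | _, ex z A => ¬ Free x (ex z A) ∨ (z ≠ y ∧ FreeFor x y A)
  | _, oc p => FreeFor x y p
  | _, wn a => FreeFor x y a

/-- The formula contains neither `?` nor `!`.  Propositions with this property are the formulas
of QC, problems with this property are the formulas of QH. -/
def Pure : {k : Kind} → Form k → Prop
  | _, var _ _ _ _ => True
  | _, fls _ => True
  | _, and A B => Pure A ∧ Pure B
  | _, or A B => Pure A ∧ Pure B
  | _, imp A B => Pure A ∧ Pure B
  | _, all _ A => Pure A
  | _, ex _ A => Pure A
  | _, oc _ => False
  | _, wn _ => False

/-- `A_◇`: classical `→` and `∀` are prefixed by `□`; atomic propositions (the constant `0`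
included), `?`, and classical `∨` and `∃` are prefixed by `□◇□`; nothing else is changed. -/
def dia : {k : Kind} → Form k → Form k
  | .problem, var _ n i t => var _ n i t
  | .proposition, var _ n i t => bdb (var _ n i t)
  | .problem, fls _ => fls _
  | .proposition, fls _ => bdb (fls _)
  | _, and A B => and (dia A) (dia B)
  | .problem, or A B => or (dia A) (dia B)
  | .proposition, or A B => bdb (or (dia A) (dia B))
  | .problem, imp A B => imp (dia A) (dia B)
  | .proposition, imp A B => box (imp (dia A) (dia B))
  | .problem, all x A => all x (dia A)
  | .proposition, all x A => box (all x (dia A))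
  | .problem, ex x A => ex x (dia A)
  | .proposition, ex x A => bdb (ex x (dia A))
  | _, oc p => oc (dia p)
  | _, wn a => bdb (wn (dia a))

end Form

open Form in
/-- The schemes of intuitionistic predicate logic, instantiated by QHC formulas of any one kind.
With the rules of modus ponens and generalization they axiomatize intuitionistic predicate logic;
with the law of excluded middle added, classical predicate logic. -/
inductive IntScheme : {k : Kind} → Form k → Prop
  | imp_k {k : Kind} (A B : Form k) : IntScheme (imp A (imp B A))
  | imp_s {k : Kind} (A B C : Form k) :
      IntScheme (imp (imp A (imp B C)) (imp (imp A B) (imp A C)))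
  | and_left {k : Kind} (A B : Form k) : IntScheme (imp (and A B) A)
  | and_right {k : Kind} (A B : Form k) : IntScheme (imp (and A B) B)
  | and_intro {k : Kind} (A B : Form k) : IntScheme (imp A (imp B (and A B)))
  | or_left {k : Kind} (A B : Form k) : IntScheme (imp A (or A B))
  | or_right {k : Kind} (A B : Form k) : IntScheme (imp B (or A B))
  | or_elim {k : Kind} (A B C : Form k) :
      IntScheme (imp (imp A C) (imp (imp B C) (imp (or A B) C)))
  | explosion {k : Kind} (A : Form k) : IntScheme (imp (fls k) A)
  | all_elim {k : Kind} (x y : ℕ) (A : Form k) (h : FreeFor x y A) :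
      IntScheme (imp (all x A) (subst x y A))
  | ex_intro {k : Kind} (x y : ℕ) (A : Form k) (h : FreeFor x y A) :
      IntScheme (imp (subst x y A) (ex x A))
  | all_intro {k : Kind} (x : ℕ) (A B : Form k) (h : ¬ Free x B) :
      IntScheme (imp (all x (imp B A)) (imp B (all x A)))
  | ex_elim {k : Kind} (x : ℕ) (A B : Form k) (h : ¬ Free x B) :
      IntScheme (imp (all x (imp A B)) (imp (ex x A) B))

open Form in
/-- `⊢ A` in the QHC calculus. -/
inductive QHC : {k : Kind} → Form k → Prop
  -- intuitionistic predicate logic for problems, classical predicate logic for propositions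
  | scheme {k : Kind} {A : Form k} (h : IntScheme A) : QHC A
  | lem (p : Form Kind.proposition) : QHC (or p (neg p))
  | mp {k : Kind} {A B : Form k} (h : QHC (imp A B)) (h' : QHC A) : QHC B
  | gen {k : Kind} {A : Form k} (x : ℕ) (h : QHC A) : QHC (all x A)
  -- first group
  | wn_and (a b : Form Kind.problem) : QHC (biimp (wn (and a b)) (and (wn a) (wn b)))
  | wn_or (a b : Form Kind.problem) : QHC (biimp (wn (or a b)) (or (wn a) (wn b)))
  | wn_imp (a b : Form Kind.problem) : QHC (imp (wn (imp a b)) (imp (wn a) (wn b)))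
  | wn_bot : QHC (neg (wn (fls Kind.problem)))
  | wn_ex (x : ℕ) (a : Form Kind.problem) : QHC (biimp (wn (ex x a)) (ex x (wn a)))
  | wn_all (x : ℕ) (a : Form Kind.problem) : QHC (imp (wn (all x a)) (all x (wn a)))
  | wn_top {a : Form Kind.problem} (h : QHC a) : QHC (wn a)
  -- second group
  | oc_bot : QHC (neg (oc (fls Kind.proposition)))
  | wn_oc (p : Form Kind.proposition) : QHC (imp (wn (oc p)) p)
  | oc_imp (p q : Form Kind.proposition) : QHC (imp (oc (imp p q)) (imp (oc p) (oc q)))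
  | oc_top {p : Form Kind.proposition} (h : QHC p) : QHC (oc p)
  -- third group
  | oc_wn (a : Form Kind.problem) : QHC (imp a (oc (wn a)))

open Form in
/-- `⊢ p` in the classical predicate calculus QC: all formulas of a derivation are formulas
of QC. -/
inductive QC : Form Kind.proposition → Prop
  | scheme {p : Form Kind.proposition} (hp : Pure p) (h : IntScheme p) : QC p
  | lem (p : Form Kind.proposition) (hp : Pure p) : QC (or p (neg p))
  | mp {p q : Form Kind.proposition} (h : QC (imp p q)) (h' : QC p) : QC q
  | gen {p : Form Kind.proposition} (x : ℕ) (h : QC p) : QC (all x p)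

/-! The axioms make `□ = ?!` an S4 modality, so the propositions `p` with `p → □p` behave
intuitionistically: implication is `□(p → q)`, negation is `□¬`, and `□◇□p = □¬□¬□p` is the double
negation of `□p`. Thus on propositions `A ↦ A_◇` is Gödel's modal translation combined with a
negative translation. Every proposition `p_◇` is boxed and stable under this double negation
(`isRegular_dia`), so a double-negated hypothesis may be stripped whenever the goal is such a
formula (`and_bdb_le`). This yields the translated axioms, excluded middle included (`qhc_dia_lem`).

For the converse on QC, deleting `?` and `!` turns QHC derivations into QC derivations
(`QHC.qc_erase`), and turns `□◇□` into `¬¬`, which is classically redundant (`erase_dia_equiv`). On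
QH the translation is the identity. -/

namespace Form

/-! ### Syntax: substitution and side conditions under the translation -/

theorem subst_self (x : ℕ) {k : Kind} (A : Form k) : subst x x A = A := by
  induction A with
  | var k n i t =>
    simp only [subst, var.injEq, heq_eq_eq, true_and]
    funext j
    split_ifs with h <;> simp [h]
  | all z A ih => simp [subst, ih]
  | ex z A ih => simp [subst, ih]
  | _ => simp_all [subst]

theorem freeFor_self (x : ℕ) {k : Kind} (A : Form k) : FreeFor x x A := by
  induction A with
  | all z A ih => by_cases h : z = x <;> simp [FreeFor, Free, h, ih]
  | ex z A ih => by_cases h : z = x <;> simp [FreeFor, Free, h, ih]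
  | _ => simp_all [FreeFor]

/-- The added prefixes bind no variables, so the side conditions of the quantifier axioms survive
translation. -/
theorem free_dia (x : ℕ) {k : Kind} (A : Form k) : Free x (dia A) ↔ Free x A := by
  induction A with
  | var k n i t => cases k <;> simp [dia, bdb, box, diamond, neg, Free]
  | fls k => cases k <;> simp [dia, bdb, box, diamond, neg, Free]
  | @or k A B ihA ihB => cases k <;> simp [dia, bdb, box, diamond, neg, Free, ihA, ihB]
  | @imp k A B ihA ihB => cases k <;> simp [dia, box, Free, ihA, ihB]
  | @all k z A ih => cases k <;> simp [dia, box, Free, ih]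
  | @ex k z A ih => cases k <;> simp [dia, bdb, box, diamond, neg, Free, ih]
  | _ => simp_all [dia, bdb, box, diamond, neg, Free]

theorem subst_dia (x y : ℕ) {k : Kind} (A : Form k) :
    dia (subst x y A) = subst x y (dia A) := by
  induction A with
  | var k n i t => cases k <;> simp [dia, bdb, box, diamond, neg, subst]
  | fls k => cases k <;> simp [dia, bdb, box, diamond, neg, subst]
  | @or k A B ihA ihB => cases k <;> simp [dia, bdb, box, diamond, neg, subst, ihA, ihB]
  | @imp k A B ihA ihB => cases k <;> simp [dia, box, subst, ihA, ihB]
  | @all k z A ih =>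
    by_cases h : z = x <;> cases k <;> simp [dia, box, subst, h, ih]
  | @ex k z A ih =>
    by_cases h : z = x <;> cases k <;> simp [dia, bdb, box, diamond, neg, subst, h, ih]
  | _ => simp_all [dia, bdb, box, diamond, neg, subst]

theorem freeFor_dia (x y : ℕ) {k : Kind} (A : Form k) :
    FreeFor x y (dia A) ↔ FreeFor x y A := by
  induction A with
  | var k n i t => cases k <;> simp [dia, bdb, box, diamond, neg, FreeFor]
  | fls k => cases k <;> simp [dia, bdb, box, diamond, neg, FreeFor]
  | @or k A B ihA ihB => cases k <;> simp [dia, bdb, box, diamond, neg, FreeFor, ihA, ihB]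
  | @imp k A B ihA ihB => cases k <;> simp [dia, box, FreeFor, ihA, ihB]
  | @all k z A ih => cases k <;> simp [dia, box, FreeFor, Free, free_dia, ih]
  | @ex k z A ih =>
    cases k <;> simp [dia, bdb, box, diamond, neg, FreeFor, Free, free_dia, ih]
  | _ => simp_all [dia, bdb, box, diamond, neg, FreeFor]

theorem dia_eq_self_of_pure {a : Form Kind.problem} (ha : a.Pure) : a.dia = a := by
  -- Induction on the indexed family needs the kind to be a variable, so it is recovered through an
  -- equation.
  suffices h : ∀ {k : Kind} (A : Form k), k = Kind.problem → A.Pure → A.dia = A from h a rfl ha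
  intro k A hk hA
  induction A with
  | oc => exact hA.elim
  | wn => exact hA.elim
  | _ => subst hk; simp_all [dia, Pure]

/-! ### Erasure of QHC onto QC -/

/-- Erase all `?` and `!`, reading problem variables as propositional ones. -/
def erase : {k : Kind} → Form k → Form Kind.proposition
  | _, var _ n i t => var _ n i t
  | _, fls _ => fls _
  | _, and A B => and (erase A) (erase B)
  | _, or A B => or (erase A) (erase B)
  | _, imp A B => imp (erase A) (erase B)
  | _, all x A => all x (erase A)
  | _, ex x A => ex x (erase A)
  | _, oc p => erase p
  | _, wn a => erase a

theorem pure_erase {k : Kind} (A : Form k) : Pure (erase A) := by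
  induction A <;> simp_all [erase, Pure]

theorem free_erase (x : ℕ) {k : Kind} (A : Form k) : Free x (erase A) ↔ Free x A := by
  induction A <;> simp_all [erase, Free]

theorem freeFor_erase (x y : ℕ) {k : Kind} (A : Form k) :
    FreeFor x y (erase A) ↔ FreeFor x y A := by
  induction A <;> simp_all [erase, FreeFor, Free, free_erase]

theorem subst_erase (x y : ℕ) {k : Kind} (A : Form k) :
    erase (subst x y A) = subst x y (erase A) := by
  induction A with
  | all z A ih => by_cases h : z = x <;> simp [erase, subst, h, ih]
  | ex z A ih => by_cases h : z = x <;> simp [erase, subst, h, ih]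
  | _ => simp_all [erase, subst]

theorem erase_eq_self_of_pure {p : Form Kind.proposition} (hp : p.Pure) : p.erase = p := by
  suffices h : ∀ {k : Kind} (A : Form k) (hk : k = Kind.proposition), A.Pure → A.erase = hk ▸ A from
    h p rfl hp
  intro k A hk hA
  induction A with
  | oc => exact hA.elim
  | wn => exact hA.elim
  | _ => subst hk; simp_all [erase, Pure]

end Form

open Form

theorem IntScheme.erase {k : Kind} {A : Form k} (h : IntScheme A) : IntScheme A.erase := by
  cases h with
  | imp_k A B => exact .imp_k _ _
  | imp_s A B C => exact .imp_s _ _ _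
  | and_left A B => exact .and_left _ _
  | and_right A B => exact .and_right _ _
  | and_intro A B => exact .and_intro _ _
  | or_left A B => exact .or_left _ _
  | or_right A B => exact .or_right _ _
  | or_elim A B C => exact .or_elim _ _ _
  | explosion A => exact .explosion _
  | all_elim x y A h =>
    simpa [Form.erase, subst_erase] using IntScheme.all_elim x y _ ((freeFor_erase x y A).2 h)
  | ex_intro x y A h =>
    simpa [Form.erase, subst_erase] using IntScheme.ex_intro x y _ ((freeFor_erase x y A).2 h)
  | all_intro x A B h => exact .all_intro x _ _ (mt (free_erase x B).1 h)
  | ex_elim x A B h => exact .ex_elim x _ _ (mt (free_erase x B).1 h)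

theorem QC.imp_refl {p : Form Kind.proposition} (hp : p.Pure) : QC (imp p p) :=
  .mp (.mp (.scheme (by simp [Form.Pure, hp]) (.imp_s p (imp p p) p))
    (.scheme (by simp [Form.Pure, hp]) (.imp_k p (imp p p))))
    (.scheme (by simp [Form.Pure, hp]) (.imp_k p p))

theorem QC.biimp_refl {p : Form Kind.proposition} (hp : p.Pure) : QC (biimp p p) :=
  .mp (.mp (.scheme (by simp [biimp, Form.Pure, hp]) (.and_intro _ _)) (.imp_refl hp)) (.imp_refl hp)

/-- Erasing `?` and `!` interprets QHC in QC. -/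
theorem QHC.qc_erase {k : Kind} {A : Form k} (h : QHC A) : QC A.erase := by
  induction h with
  | scheme h => exact .scheme (pure_erase _) h.erase
  | lem p => exact .lem _ (pure_erase p)
  | mp _ _ ih ih' => exact .mp ih ih'
  | gen x _ ih => exact .gen x ih
  -- From here on, both sides of each axiom for `?` and `!` erase to the same formula, and the two
  -- rules erase to no step at all.
  | wn_and a b => exact .biimp_refl (pure_erase (and a b))
  | wn_or a b => exact .biimp_refl (pure_erase (or a b))
  | wn_imp a b => exact .imp_refl (pure_erase (imp a b))
  | wn_bot => exact .imp_refl (pure_erase (fls Kind.problem))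
  | wn_ex x a => exact .biimp_refl (pure_erase (ex x a))
  | wn_all x a => exact .imp_refl (pure_erase (all x a))
  | wn_top _ ih => exact ih
  | oc_bot => exact .imp_refl (pure_erase (fls Kind.proposition))
  | wn_oc p => exact .imp_refl (pure_erase p)
  | oc_imp p q => exact .imp_refl (pure_erase (imp p q))
  | oc_top _ ih => exact ih
  | oc_wn a => exact .imp_refl (pure_erase a)

theorem QC.qhc {p : Form Kind.proposition} (h : QC p) : QHC p := by
  induction h with
  | scheme _ h => exact .scheme h
  | lem p _ => exact .lem p
  | mp _ _ ih ih' => exact .mp ih ih'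
  | gen x _ ih => exact .gen x ih

/-! ### Derived rules for provable implication -/

namespace Form

/-- Provable implication. -/
def Le {k : Kind} (A B : Form k) : Prop := QHC (imp A B)

namespace Le

variable {k : Kind} {A B C D : Form k}

theorem of_qhc (h : QHC B) : Le A B := QHC.mp (.scheme (.imp_k _ _)) h

theorem mp (h : Le A (imp B C)) (h' : Le A B) : Le A C :=
  QHC.mp (QHC.mp (.scheme (.imp_s _ _ _)) h) h'

theorem refl (A : Form k) : Le A A :=
  mp (B := imp A A) (.scheme (.imp_k _ _)) (.scheme (.imp_k _ _))

theorem trans (h : Le A B) (h' : Le B C) : Le A C := mp (of_qhc h') h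

theorem and_left : Le (and A B) A := .scheme (.and_left _ _)

theorem and_right : Le (and A B) B := .scheme (.and_right _ _)

theorem le_and (h : Le C A) (h' : Le C B) : Le C (and A B) :=
  mp (trans h (.scheme (.and_intro _ _))) h'

theorem curry (h : Le (and A B) C) : Le A (imp B C) :=
  trans (.scheme (.and_intro A B)) (QHC.mp (.scheme (.imp_s _ _ _)) (of_qhc h))

theorem uncurry (h : Le A (imp B C)) : Le (and A B) C := mp (trans and_left h) and_right

theorem and_comm : Le (and A B) (and B A) := le_and and_right and_left

theorem and_mono (h : Le A C) (h' : Le B D) : Le (and A B) (and C D) :=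
  le_and (trans and_left h) (trans and_right h')

theorem imp_mono (h : Le C A) (h' : Le B D) : Le (imp A B) (imp C D) :=
  curry (trans (mp and_left (trans and_right h)) h')

theorem or_left : Le A (or A B) := .scheme (.or_left _ _)

theorem or_right : Le B (or A B) := .scheme (.or_right _ _)

theorem or_elim (h : Le A C) (h' : Le B C) : Le (or A B) C :=
  QHC.mp (QHC.mp (.scheme (.or_elim _ _ _)) h) h'

theorem and_or_elim (h : Le (and D A) C) (h' : Le (and D B) C) : Le (and D (or A B)) C :=
  trans and_comm (uncurry (or_elim (curry (trans and_comm h)) (curry (trans and_comm h'))))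

theorem or_mono (h : Le A C) (h' : Le B D) : Le (or A B) (or C D) :=
  or_elim (trans h or_left) (trans h' or_right)

theorem explosion : Le (fls k) A := .scheme (.explosion _)

theorem all_elim (x : ℕ) : Le (all x A) A := by
  have h : QHC (imp (all x A) (subst x x A)) := .scheme (.all_elim x x A (freeFor_self x A))
  rwa [subst_self] at h

theorem ex_intro (x : ℕ) : Le A (ex x A) := by
  have h : QHC (imp (subst x x A) (ex x A)) := .scheme (.ex_intro x x A (freeFor_self x A))
  rwa [subst_self] at h

theorem le_all {x : ℕ} (hx : ¬ Free x B) (h : Le B A) : Le B (all x A) :=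
  QHC.mp (.scheme (.all_intro x A B hx)) (.gen x h)

theorem ex_le {x : ℕ} (hx : ¬ Free x B) (h : Le A B) : Le (ex x A) B :=
  QHC.mp (.scheme (.ex_elim x A B hx)) (.gen x h)

theorem and_ex_elim {x : ℕ} (hC : ¬ Free x C) (hB : ¬ Free x B) (h : Le (and C A) B) :
    Le (and C (ex x A)) B :=
  trans and_comm (uncurry (ex_le (by simp [Free, hC, hB]) (curry (trans and_comm h))))

theorem all_mono (x : ℕ) (h : Le A B) : Le (all x A) (all x B) :=
  le_all (by simp [Free]) (trans (all_elim x) h)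

theorem ex_mono (x : ℕ) (h : Le A B) : Le (ex x A) (ex x B) :=
  ex_le (by simp [Free]) (trans h (ex_intro x))

theorem of_biimp (h : QHC (biimp A B)) : Le A B := QHC.mp (.scheme (.and_left _ _)) h

theorem of_biimp' (h : QHC (biimp A B)) : Le B A := QHC.mp (.scheme (.and_right _ _)) h

theorem and_neg : Le (and A (neg A)) (fls k) := mp and_right and_left

theorem le_neg_neg : Le A (neg (neg A)) := curry and_neg

/-- This use of excluded middle serves only the comparison of erased formulas; the modal calculus
below does without it. -/
theorem neg_neg_le {p : Form Kind.proposition} : Le (neg (neg p)) p :=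
  QHC.mp (or_elim (curry and_left) (curry (trans and_neg explosion))) (.lem p)

end Le

/-! ### The modality `□` -/

section Modal

variable {p q r u : Form Kind.proposition}

theorem oc_mono (h : Le p q) : Le (oc p) (oc q) := QHC.mp (.oc_imp p q) (.oc_top h)

theorem wn_mono {a b : Form Kind.problem} (h : Le a b) : Le (wn a) (wn b) :=
  QHC.mp (.wn_imp a b) (.wn_top h)

/-- Applying `?` to `α → !?α` gives S4 transitivity; it makes every `?α`, in particular every `□p`,
boxed. -/
theorem wn_le_box (a : Form Kind.problem) : Le (wn a) (box (wn a)) := wn_mono (.oc_wn a)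

theorem box_mono (h : Le p q) : Le (box p) (box q) := wn_mono (oc_mono h)

theorem box_le : Le (box p) p := .wn_oc p

theorem box_intro (h : QHC p) : QHC (box p) := .wn_top (.oc_top h)

/-- `p` implies `□p`. -/
def IsBoxed (p : Form Kind.proposition) : Prop := Le p (box p)

theorem isBoxed_box : IsBoxed (box p) := wn_le_box _

theorem le_box (hp : IsBoxed p) (h : Le p q) : Le p (box q) := .trans hp (box_mono h)

theorem box_and_le : Le (and (box p) (box q)) (box (and p q)) :=
  .mp (.trans .and_left (.trans (box_mono (.scheme (.and_intro p q)))
    (.trans (wn_mono (.oc_imp _ _)) (.wn_imp _ _)))) .and_right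

theorem IsBoxed.and (hp : IsBoxed p) (hq : IsBoxed q) : IsBoxed (and p q) :=
  .trans (.and_mono hp hq) box_and_le

/-- The negation on boxed propositions. -/
abbrev boxNeg (p : Form Kind.proposition) : Form Kind.proposition := box (neg p)

theorem le_boxNeg (hu : IsBoxed u) (h : Le (and u p) (fls _)) : Le u (boxNeg p) :=
  le_box hu (.curry h)

theorem and_boxNeg : Le (and p (boxNeg p)) (fls _) := .mp (.trans .and_right box_le) .and_left

/-- Boxed propositions that agree with their double negation. -/
structure IsRegular (p : Form Kind.proposition) : Prop where
  boxed : IsBoxed p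
  le : Le (boxNeg (boxNeg p)) p

theorem le_bdb_of_le (hp : IsBoxed p) (h : Le p q) : Le p (bdb q) :=
  .trans (le_box hp h) (le_boxNeg isBoxed_box and_boxNeg)

theorem le_bdb (hp : IsBoxed p) : Le p (bdb p) :=
  le_bdb_of_le hp (.refl _)

/-- In the context `u`, the negation of `r` refutes `□p`, contradicting `□◇□p`; regularity of `r`
then removes the double negation. The context must be boxed for the refutation to be boxed. -/
theorem and_bdb_le (hu : IsBoxed u) (hr : IsRegular r) (h : Le (and u p) r) :
    Le (and u (bdb p)) r := by
  refine .trans (le_boxNeg (hu.and isBoxed_box) ?_) hr.le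
  have h₁ : Le (and u (boxNeg r)) (boxNeg (box p)) := by
    refine le_boxNeg (hu.and isBoxed_box) (.trans (.le_and ?_ (.trans .and_left .and_right))
      and_boxNeg)
    exact .trans (.and_mono .and_left box_le) h
  exact .trans (.le_and (.trans (.and_mono .and_left (.refl _)) h₁)
    (.trans .and_left .and_right)) and_boxNeg

theorem bdb_le (hr : IsRegular r) (h : Le p r) : Le (bdb p) r :=
  .trans (.le_and (.of_qhc (Le.refl (fls _))) (.refl _))
    -- The trivial context `0 → 0` is boxed because its box is provable.
    (and_bdb_le (u := imp (fls _) (fls _)) (.of_qhc (box_intro (Le.refl _))) hr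
      (.trans .and_right h))

theorem bdb_fls_le : Le (bdb (fls _)) (fls Kind.proposition) :=
  .mp (.trans box_le (.refl _)) (.of_qhc (box_intro box_le))

/-- For boxed `p` the inner `□` of `□◇□p` is redundant, so `□◇□` may replace the double negation of
`p`. -/
theorem isRegular_of_bdb_le (hp : IsBoxed p) (h : Le (bdb p) p) : IsRegular p where
  boxed := hp
  le := .trans (box_mono (.imp_mono (box_mono (.imp_mono hp (.refl _))) (.refl _))) h

theorem bdb_mono (h : Le p q) : Le (bdb p) (bdb q) :=
  box_mono (.imp_mono (box_mono (.imp_mono (box_mono h) (.refl _))) (.refl _))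

/-- Triple negation collapses to a single one, as in intuitionistic logic. -/
theorem isRegular_bdb : IsRegular (bdb p) where
  boxed := isBoxed_box
  le := le_boxNeg isBoxed_box <| .trans
    (.le_and (.trans .and_right (le_boxNeg isBoxed_box and_boxNeg)) .and_left) and_boxNeg

theorem IsRegular.and (hp : IsRegular p) (hq : IsRegular q) : IsRegular (and p q) :=
  isRegular_of_bdb_le (hp.boxed.and hq.boxed) (.le_and (bdb_le hp .and_left) (bdb_le hq .and_right))

theorem IsRegular.box_imp (hp : IsBoxed p) (hq : IsRegular q) : IsRegular (box (imp p q)) :=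
  isRegular_of_bdb_le isBoxed_box <| le_box isBoxed_box <| .curry <| .trans .and_comm <|
    and_bdb_le hp hq (.mp (.trans .and_right box_le) .and_left)

theorem IsRegular.box_all (x : ℕ) (hp : IsRegular p) : IsRegular (box (all x p)) :=
  isRegular_of_bdb_le isBoxed_box <| le_box isBoxed_box <|
    .le_all (by simp [bdb, box, diamond, neg, Free]) <| bdb_le hp (.trans box_le (.all_elim x))

theorem isBoxed_wn (a : Form Kind.problem) : IsBoxed (wn a) := wn_le_box a

theorem isRegular_dia (p : Form Kind.proposition) : IsRegular p.dia := by
  suffices h : ∀ {k : Kind} (A : Form k) (hk : k = Kind.proposition), IsRegular (hk ▸ A).dia from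
    h p rfl
  intro k A hk
  induction A with
  | oc => cases hk
  | and A B ihA ihB => subst hk; exact (ihA rfl).and (ihB rfl)
  | imp A B ihA ihB => subst hk; exact .box_imp (ihA rfl).boxed (ihB rfl)
  | all x A ih => subst hk; exact .box_all x (ih rfl)
  | wn a => exact isRegular_bdb
  | _ => subst hk; exact isRegular_bdb

theorem box_imp_intro (h : Le p q) : QHC (box (imp p q)) := box_intro h

theorem box_imp_imp_intro (hp : IsBoxed p) (h : Le (and p q) r) :
    QHC (box (imp p (box (imp q r)))) := box_intro (le_box hp (.curry h))

theorem box_imp_le (h : Le u (box (imp p q))) (h' : Le u p) : Le u q := .mp (.trans h box_le) h'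

theorem qhc_and {k : Kind} {A B : Form k} (h : QHC A) (h' : QHC B) : QHC (and A B) :=
  QHC.mp (QHC.mp (.scheme (.and_intro A B)) h) h'

end Modal

/-! ### Translated axioms and rules -/

theorem qhc_dia_of_intScheme {p : Form Kind.proposition} (h : IntScheme p) : QHC p.dia := by
  cases h with
  | imp_k A B => exact box_imp_imp_intro (isRegular_dia A).boxed .and_left
  | imp_s A B C =>
    exact box_imp_imp_intro isBoxed_box <| le_box (isBoxed_box.and isBoxed_box) <| .curry <|
      box_imp_le (box_imp_le (.trans .and_left .and_left) .and_right)
        (box_imp_le (.trans .and_left .and_right) .and_right)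
  | and_left A B => exact box_imp_intro .and_left
  | and_right A B => exact box_imp_intro .and_right
  | and_intro A B => exact box_imp_imp_intro (isRegular_dia A).boxed (.refl _)
  | or_left A B => exact box_imp_intro (le_bdb_of_le (isRegular_dia A).boxed .or_left)
  | or_right A B => exact box_imp_intro (le_bdb_of_le (isRegular_dia B).boxed .or_right)
  | or_elim A B C =>
    exact box_imp_imp_intro isBoxed_box <| le_box (isBoxed_box.and isBoxed_box) <| .curry <|
      -- Case analysis on a double-negated disjunction is allowed because the conclusion `C_◇` is
      -- regular.
      and_bdb_le (isBoxed_box.and isBoxed_box) (isRegular_dia C) <| .and_or_elim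
        (box_imp_le (.trans .and_left .and_left) .and_right)
        (box_imp_le (.trans .and_left .and_right) .and_right)
  | explosion A => exact box_imp_intro (bdb_le (isRegular_dia A) .explosion)
  | all_elim x y A h =>
    refine box_imp_intro (.trans box_le ?_)
    rw [subst_dia]
    exact QHC.scheme (.all_elim x y _ ((freeFor_dia x y A).2 h))
  | ex_intro x y A h =>
    refine box_imp_intro (le_bdb_of_le (isRegular_dia _).boxed ?_)
    rw [subst_dia]
    exact QHC.scheme (.ex_intro x y _ ((freeFor_dia x y A).2 h))
  | all_intro x A B h =>
    have hB := mt (free_dia x B).1 h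
    exact box_imp_imp_intro isBoxed_box <| le_box (isBoxed_box.and (isRegular_dia B).boxed) <|
      .le_all (by simp [dia, box, Free, hB]) <|
        box_imp_le (.trans .and_left (.trans box_le (.all_elim x))) .and_right
  | ex_elim x A B h =>
    have hB := mt (free_dia x B).1 h
    exact box_imp_imp_intro isBoxed_box <| and_bdb_le isBoxed_box (isRegular_dia B) <|
      .and_ex_elim (by simp [dia, box, Free]) hB <|
        box_imp_le (.trans .and_left (.trans box_le (.all_elim x))) .and_right

/-- The intuitionistic proof of `¬¬(p ∨ ¬p)`: refuting the disjunction refutes `p`, which proves the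
disjunction. -/
theorem qhc_dia_lem (p : Form Kind.proposition) : QHC (or p (neg p)).dia := by
  have hp := isRegular_dia p
  let q := or p.dia (box (imp p.dia (bdb (fls _))))
  refine box_intro (?_ : Le (boxNeg (box q)) (fls _))
  have h : Le (boxNeg (box q)) (box (imp p.dia (bdb (fls _)))) :=
    le_box isBoxed_box <| .curry <| .trans (.le_and
      (.trans .and_right (le_box hp.boxed .or_left)) .and_left) (.trans and_boxNeg .explosion)
  exact .trans (.le_and (.trans h (le_box isBoxed_box .or_right)) (.refl _)) and_boxNeg

end Form

theorem IntScheme.qhc_dia {k : Kind} {A : Form k} (h : IntScheme A) : QHC A.dia := by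
  cases k with
  | proposition => exact qhc_dia_of_intScheme h
  | problem =>
    refine QHC.scheme ?_
    cases h with
    | imp_k A B => exact .imp_k _ _
    | imp_s A B C => exact .imp_s _ _ _
    | and_left A B => exact .and_left _ _
    | and_right A B => exact .and_right _ _
    | and_intro A B => exact .and_intro _ _
    | or_left A B => exact .or_left _ _
    | or_right A B => exact .or_right _ _
    | or_elim A B C => exact .or_elim _ _ _
    | explosion A => exact .explosion _
    | all_elim x y A h =>
      simpa [dia, subst_dia] using IntScheme.all_elim x y _ ((freeFor_dia x y A).2 h)
    | ex_intro x y A h =>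
      simpa [dia, subst_dia] using IntScheme.ex_intro x y _ ((freeFor_dia x y A).2 h)
    | all_intro x A B h => exact .all_intro x _ _ (mt (free_dia x B).1 h)
    | ex_elim x A B h => exact .ex_elim x _ _ (mt (free_dia x B).1 h)

/-- The translation `A ↦ A_◇` interprets QHC in itself. -/
theorem QHC.dia {k : Kind} {A : Form k} (h : QHC A) : QHC A.dia := by
  induction h with
  | scheme h => exact h.qhc_dia
  | lem p => exact qhc_dia_lem p
  | @mp k A B _ _ ih ih' =>
    cases k with
    | problem => exact .mp ih ih'
    -- The translated implication is boxed, so `?!p → p` must unbox it before detachment.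
    | proposition => exact .mp (.mp (.wn_oc _) ih) ih'
  | @gen k A x _ ih =>
    cases k with
    | problem => exact .gen x ih
    | proposition => exact box_intro (.gen x ih)
  | wn_and a b =>
    refine qhc_and (box_imp_intro (.le_and (bdb_mono (wn_mono .and_left))
      (bdb_mono (wn_mono .and_right)))) (box_imp_intro ?_)
    -- The two prefixes `□◇□` are stripped one at a time, with the other conjunct as the boxed
    -- context.
    refine and_bdb_le isBoxed_box isRegular_bdb (.trans .and_comm ?_)
    exact and_bdb_le (isBoxed_wn _) isRegular_bdb <| .trans .and_comm <|
      le_bdb_of_le ((isBoxed_wn _).and (isBoxed_wn _)) (.of_biimp' (.wn_and _ _))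
  | wn_or a b =>
    refine qhc_and (box_imp_intro ?_) (box_imp_intro ?_)
    · refine bdb_mono (.trans (.of_biimp (.wn_or _ _)) ?_)
      exact .or_mono (le_bdb (isBoxed_wn _)) (le_bdb (isBoxed_wn _))
    · exact bdb_le isRegular_bdb (.or_elim (bdb_mono (wn_mono .or_left))
        (bdb_mono (wn_mono .or_right)))
  | wn_imp a b =>
    refine box_imp_intro (bdb_le (.box_imp isBoxed_box isRegular_bdb) ?_)
    refine le_box (isBoxed_wn _) (.curry (and_bdb_le (isBoxed_wn _) isRegular_bdb ?_))
    exact le_bdb_of_le ((isBoxed_wn _).and (isBoxed_wn _)) (.uncurry (.wn_imp _ _))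
  | wn_bot => exact box_imp_intro (bdb_mono .wn_bot)
  | wn_ex x a =>
    refine qhc_and (box_imp_intro ?_) (box_imp_intro ?_)
    · exact bdb_mono (.trans (.of_biimp (.wn_ex x _)) (.ex_mono x (le_bdb (isBoxed_wn _))))
    · refine bdb_le isRegular_bdb (Le.ex_le (B := bdb (wn (ex x a.dia)))
        (by simp [bdb, box, diamond, neg, Free]) ?_)
      exact bdb_mono (wn_mono (.ex_intro x))
  | wn_all x a =>
    refine box_imp_intro (bdb_le (.box_all x isRegular_bdb) (le_box (isBoxed_wn _) ?_))
    exact .trans (.wn_all x _) (.all_mono x (le_bdb (isBoxed_wn _)))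
  | wn_top _ ih => exact .mp (le_bdb (isBoxed_wn _)) (.wn_top ih)
  | oc_bot => exact Le.trans (oc_mono bdb_fls_le) .oc_bot
  | wn_oc p => exact box_imp_intro (bdb_le (isRegular_dia p) box_le)
  | oc_imp p q => exact Le.trans (oc_mono box_le) (.oc_imp _ _)
  | oc_top _ ih => exact .oc_top ih
  | oc_wn a => exact Le.trans (.oc_wn _) (oc_mono (le_bdb (isBoxed_wn _)))

/-! ### The converse via erasure -/

namespace Form

/-- Erasing the modalities from `A_◇` only leaves double negations. -/
theorem erase_dia_equiv {k : Kind} (A : Form k) :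
    Le A.dia.erase A.erase ∧ Le A.erase A.dia.erase := by
  have nn {p q : Form Kind.proposition} (h : Le p q ∧ Le q p) :
      Le (neg (neg p)) q ∧ Le q (neg (neg p)) :=
    ⟨.trans .neg_neg_le h.1, .trans h.2 .le_neg_neg⟩
  induction A with
  | var k n i t =>
    cases k
    · exact ⟨.refl _, .refl _⟩
    · exact nn ⟨.refl _, .refl _⟩
  | fls k =>
    cases k
    · exact ⟨.refl _, .refl _⟩
    · exact nn ⟨.refl _, .refl _⟩
  | @and k A B ihA ihB =>
    have h := And.intro (Le.and_mono ihA.1 ihB.1) (Le.and_mono ihA.2 ihB.2)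
    cases k <;> exact h
  | @or k A B ihA ihB =>
    have h := And.intro (Le.or_mono ihA.1 ihB.1) (Le.or_mono ihA.2 ihB.2)
    cases k
    · exact h
    · exact nn h
  | @imp k A B ihA ihB =>
    have h := And.intro (Le.imp_mono ihA.2 ihB.1) (Le.imp_mono ihA.1 ihB.2)
    cases k <;> exact h
  | @all k x A ih =>
    have h := And.intro (Le.all_mono x ih.1) (Le.all_mono x ih.2)
    cases k <;> exact h
  | @ex k x A ih =>
    have h := And.intro (Le.ex_mono x ih.1) (Le.ex_mono x ih.2)
    cases k
    · exact h
    · exact nn h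
  | oc p ih => exact ih
  | wn a ih => exact nn ih

theorem qc_of_qhc_dia {p : Form Kind.proposition} (hp : p.Pure) (h : QHC p.dia) : QC p := by
  -- The equivalence of erasures lives in QHC, so the erased derivation is moved there and the
  -- result is erased once more to land in QC.
  have h' : QHC p := by
    simpa only [erase_eq_self_of_pure hp] using
      QHC.mp (erase_dia_equiv p).1 (QC.qhc (QHC.qc_erase h))
  simpa only [erase_eq_self_of_pure hp] using h'.qc_erase

end Form

theorem mainTheorem7 :
    -- the translation `A ↦ A_◇`, which preserves types, is an interpretation of QHC in itself
    (∀ (k : Kind) (A : Form k), QHC A → QHC A.dia) ∧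
    -- the converse for formulas of QC
    (∀ p : Form Kind.proposition, p.Pure → QHC p.dia → QHC p) ∧
    -- the converse for formulas of QH
    (∀ a : Form Kind.problem, a.Pure → QHC a.dia → QHC a) ∧
    -- it restricts to an embedding of QC into QHC
    (∀ p : Form Kind.proposition, p.Pure → (QC p ↔ QHC p.dia)) :=
  ⟨fun _ _ => QHC.dia, fun _ hp h => (qc_of_qhc_dia hp h).qhc,
    fun _ ha h => dia_eq_self_of_pure ha ▸ h, fun _ hp => ⟨fun h => h.qhc.dia, qc_of_qhc_dia hp⟩⟩
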